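/- A numerical semigroup is a set $S\subseteq\mathbb{Z}_{\ge 0}$ that contains $0$, is closed under addition and has finite complement in $\mathbb{Z}_{\ge 0}$; its embedding dimension is the cardinality of its (unique) minimal generating set. Let $P_S(x)=(1-x)\sum_{s\in S}x^s$, which is a polynomial. Call $S$ symmetric if $P_S(x)=x^kP_S(x^{-1})$ for some integer $k\ge 0$, and cyclotomic if every complex root of $P_S$ lies on the unit circle. Let $SY_e$ and $CY_e$ denote the sets of symmetric and of cyclotomic numerical semigroups, respectively, of embedding dimension $e$. Theorem 2. For every integer $e\ge 4$ there exist two distinct numerical semigroups of embedding dimension $e$ each of which is symmetric but not cyclotomic. In particular, $CY_e\neq SY_e$. -/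

import Mathlib

/-- A numerical semigroup: a subset of `ℕ` that contains `0`, is closed under addition and contains
all but finitely many natural numbers. -/
structure NumericalSemigroup extends AddSubmonoid ℕ where
  finite_compl : (carrierᶜ).Finite

namespace NumericalSemigroup

/-- The Hilbert series `H_S(x) = ∑_{s ∈ S} x ^ s`, a formal power series. -/
noncomputable def hilbertSeries (S : NumericalSemigroup) : PowerSeries ℤ :=
  PowerSeries.mk (S.carrier.indicator 1)

/-- The finite set `ℕ \ S` of gaps of `S`. -/
noncomputable def gaps (S : NumericalSemigroup) : Finset ℕ :=
  S.finite_compl.toFinset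

/-- The numerical semigroup polynomial `P_S(x) = (1 - x) H_S(x)`, written as a polynomial by means of
`H_S(x) = 1 / (1 - x) - ∑_{g ∉ S} x ^ g`. The defining identity is proved in
`coe_semigroupPolynomial`. -/
noncomputable def semigroupPolynomial (S : NumericalSemigroup) : Polynomial ℤ :=
  1 - (1 - Polynomial.X) * ∑ g ∈ S.gaps, Polynomial.X ^ g

/-- The defining identity `P_S(x) = (1 - x) H_S(x)`, in the ring of formal power series. -/
theorem coe_semigroupPolynomial (S : NumericalSemigroup) :
    (S.semigroupPolynomial : PowerSeries ℤ) = (1 - PowerSeries.X) * S.hilbertSeries := by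
  have h1 : S.hilbertSeries + ((∑ g ∈ S.gaps, Polynomial.X ^ g : Polynomial ℤ) : PowerSeries ℤ)
      = PowerSeries.mk 1 := by
    ext n
    by_cases hn : n ∈ S.carrier <;>
      simp [hilbertSeries, gaps, Polynomial.coeff_X_pow, hn]
  have h2 : (1 - PowerSeries.X) * (PowerSeries.mk 1 : PowerSeries ℤ) = 1 := by
    rw [mul_comm]
    exact PowerSeries.mk_one_mul_one_sub_eq_one ℤ
  have h3 : (S.semigroupPolynomial : PowerSeries ℤ) = 1 - (1 - PowerSeries.X) *
      ((∑ g ∈ S.gaps, Polynomial.X ^ g : Polynomial ℤ) : PowerSeries ℤ) := by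
    simp only [semigroupPolynomial, Polynomial.coe_sub, Polynomial.coe_mul, Polynomial.coe_one,
      Polynomial.coe_X]
  rw [h3]
  linear_combination -h2 - (1 - PowerSeries.X) * h1

/-- `A` is the minimal generating set of `S`: it generates `S`, and no proper subset of it does. -/
def IsMinimalGeneratingSet (S : NumericalSemigroup) (A : Finset ℕ) : Prop :=
  Minimal (fun B : Finset ℕ => AddSubmonoid.closure (B : Set ℕ) = S.toAddSubmonoid) A

/-- `S` has embedding dimension `e`: its minimal generating set has exactly `e` elements. -/
def HasEmbeddingDimension (S : NumericalSemigroup) (e : ℕ) : Prop :=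
  ∃ A : Finset ℕ, S.IsMinimalGeneratingSet A ∧ A.card = e

/-- `S` is symmetric: `P_S(x) = x ^ k * P_S(x⁻¹)` for some natural number `k`, as an identity of
Laurent polynomials. -/
def IsSymmetric (S : NumericalSemigroup) : Prop :=
  ∃ k : ℕ, S.semigroupPolynomial.toLaurent =
    LaurentPolynomial.T (k : ℤ) * LaurentPolynomial.invert S.semigroupPolynomial.toLaurent

/-- `S` is cyclotomic: every complex root of `P_S` lies on the unit circle. -/
def IsCyclotomic (S : NumericalSemigroup) : Prop :=
  ∀ z : ℂ, Polynomial.aeval z S.semigroupPolynomial = 0 → ‖z‖ = 1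

/-- `SY_e`: the set of symmetric numerical semigroups of embedding dimension `e`. -/
def SY (e : ℕ) : Set NumericalSemigroup :=
  {S | S.HasEmbeddingDimension e ∧ S.IsSymmetric}

/-- `CY_e`: the set of cyclotomic numerical semigroups of embedding dimension `e`. -/
def CY (e : ℕ) : Set NumericalSemigroup :=
  {S | S.HasEmbeddingDimension e ∧ S.IsCyclotomic}

end NumericalSemigroup

/-! Write P = P_S, so P(0) = 1. The power series P'/P has n-th coefficient -∑ α^(-(n+1)), summed
over the roots α with multiplicity. If all roots lie on the unit circle, every such coefficient has
absolute value at most deg P. It therefore suffices to exhibit one coefficient that is too large.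

The two witnesses have multiplicity e + 1 and palindromic, sparse P of degree 2e + 2 and 2e + 4.
Comparing coefficients in P · Q = P' gives a short linear recursion for Q = P'/P. Solving it up to
index 2e + 4, respectively 2e + 6, yields -(2e + 6) and -(2e + 8), beyond the degree in both cases.
The second computation needs e ≥ 5; for e = 4 the coefficient at 16 is -18, against degree 12. -/

/-! ### Logarithmic derivatives and roots on the unit circle -/

open Polynomial in
/-- If all the roots of `P` lie on the unit circle and `P 0 = 1`, then the coefficients of the
logarithmic derivative of `P` at `0` are bounded by the degree of `P`. -/
theorem Polynomial.exists_logDeriv_coeff_le (P : ℂ[X]) (h0 : P.coeff 0 = 1)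
    (hP : ∀ z : ℂ, P.IsRoot z → ‖z‖ = 1) :
    ∃ Q : PowerSeries ℂ, (P : PowerSeries ℂ) * Q = (derivative P : ℂ[X]) ∧
      ∀ n, ‖PowerSeries.coeff n Q‖ ≤ P.natDegree := by
  have key : ∀ (c : ℂ) (s : Multiset ℂ), (∀ z ∈ s, ‖z‖ = 1) → ∃ Q : PowerSeries ℂ,
      ((C c * (s.map fun z => X - C z).prod : ℂ[X]) : PowerSeries ℂ) * Q =
        (derivative (C c * (s.map fun z => X - C z).prod) : ℂ[X]) ∧
      ∀ n, ‖PowerSeries.coeff n Q‖ ≤ s.card := by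
    intro c s
    induction s using Multiset.induction with
    | empty => exact fun _ => ⟨0, by simp, by simp⟩
    | cons a s ih =>
      intro hs
      obtain ⟨Q, hQ, hQn⟩ := ih fun z hz => hs z (Multiset.mem_cons_of_mem hz)
      have ha : ‖a‖ = 1 := hs a (Multiset.mem_cons_self a s)
      have ha0 : a ≠ 0 := fun h => by simp [h] at ha
      -- The expansion of 1/(X - a) at 0. Its coefficients have norm 1, so each root adds at most 1
      -- to the bound.
      let G : PowerSeries ℂ := PowerSeries.mk fun n => -(a⁻¹) ^ (n + 1)
      have hG : ((X - C a : ℂ[X]) : PowerSeries ℂ) * G = 1 := by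
        ext n
        rw [Polynomial.coe_sub, Polynomial.coe_X, Polynomial.coe_C, sub_mul, map_sub,
          PowerSeries.coeff_C_mul]
        cases n with
        | zero => simp [G, ha0]
        | succ n =>
          rw [PowerSeries.coeff_succ_X_mul]
          simp only [G, PowerSeries.coeff_mk, PowerSeries.coeff_one]
          rw [pow_succ (a⁻¹) (n + 1)]
          simp
          field_simp
          ring
      refine ⟨Q + G, ?_, fun n => ?_⟩
      · set R : ℂ[X] := C c * (s.map fun z => X - C z).prod
        have hR : (C c * ((a ::ₘ s).map fun z => X - C z).prod : ℂ[X]) = (X - C a) * R := by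
          simp only [Multiset.map_cons, Multiset.prod_cons, R]; ring
        rw [hR, derivative_mul, Polynomial.coe_add, Polynomial.coe_mul (X - C a) R,
          Polynomial.coe_mul (derivative (X - C a)) R,
          Polynomial.coe_mul (X - C a) (derivative R), ← hQ]
        simp only [derivative_sub, derivative_X, derivative_C, sub_zero, Polynomial.coe_one]
        linear_combination (R : PowerSeries ℂ) * hG
      · rw [map_add, Multiset.card_cons]
        push_cast
        refine (norm_add_le _ _).trans (add_le_add (hQn n) ?_)
        simp [G, ha]
  have hsplit := IsAlgClosed.splits P
  have hP0 : P ≠ 0 := fun h => by simp [h] at h0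
  obtain ⟨Q, hQ, hQn⟩ := key P.leadingCoeff P.roots fun z hz => hP z (isRoot_of_mem_roots hz)
  rw [← hsplit.eq_prod_roots] at hQ
  exact ⟨Q, hQ, fun n => (hQn n).trans (by exact_mod_cast P.card_roots')⟩

namespace NumericalSemigroup

/-- Generators in `[m, 2m)` form a minimal generating set. -/
theorem hasEmbeddingDimension_of_subset_Ico {S : NumericalSemigroup} {A : Finset ℕ} {m : ℕ}
    (hA : A ⊆ Finset.Ico m (2 * m))
    (h : AddSubmonoid.closure (A : Set ℕ) = S.toAddSubmonoid) :
    S.HasEmbeddingDimension A.card := by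
  refine ⟨A, ⟨h, fun B hB hBA a ha => ?_⟩, rfl⟩
  -- A sum of two generators is at least 2m, so no generator below 2m is redundant.
  have hcl : ∀ x ∈ AddSubmonoid.closure (B : Set ℕ), x = 0 ∨ x ∈ B ∨ 2 * m ≤ x := by
    intro x hx
    have hge : ∀ b ∈ B, m ≤ b := fun b hb => (Finset.mem_Ico.1 (hA (hBA hb))).1
    induction hx using AddSubmonoid.closure_induction with
    | mem x hx => exact Or.inr (Or.inl hx)
    | zero => exact Or.inl rfl
    | add x y _ _ hx hy =>
      rcases hx with rfl | hx | hx
      · simpa using hy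
      · rcases hy with rfl | hy | hy
        · exact Or.inr (Or.inl hx)
        · have := hge x hx
          have := hge y hy
          omega
        · omega
      · omega
  have hmem : a ∈ AddSubmonoid.closure (B : Set ℕ) := by
    have hB' : AddSubmonoid.closure (B : Set ℕ) = S.toAddSubmonoid := hB
    rw [hB', ← h]
    exact AddSubmonoid.subset_closure ha
  have := Finset.mem_Ico.1 (hA ha)
  rcases hcl a hmem with h | h | h
  · omega
  · exact h
  · omega

/-- For a cyclotomic numerical semigroup the coefficients of the logarithmic derivative of the
semigroup polynomial are bounded by its degree. -/
theorem IsCyclotomic.exists_logDeriv_coeff_le {S : NumericalSemigroup} (hS : S.IsCyclotomic)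
    (h0 : S.semigroupPolynomial.coeff 0 = 1) {d : ℕ} (hd : S.semigroupPolynomial.natDegree ≤ d) :
    ∃ Q : PowerSeries ℂ, ((S.semigroupPolynomial.map (Int.castRingHom ℂ) : Polynomial ℂ) :
        PowerSeries ℂ) * Q =
        (Polynomial.derivative (S.semigroupPolynomial.map (Int.castRingHom ℂ)) : Polynomial ℂ) ∧
      ∀ n, ‖PowerSeries.coeff n Q‖ ≤ d := by
  obtain ⟨Q, hQ, hn⟩ := Polynomial.exists_logDeriv_coeff_le
    (S.semigroupPolynomial.map (Int.castRingHom ℂ)) (by simp [h0]) fun z hz => hS z (by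
      rwa [Polynomial.IsRoot, Polynomial.eval_map, ← algebraMap_int_eq,
        ← Polynomial.aeval_def] at hz)
  refine ⟨Q, hQ, fun n => (hn n).trans ?_⟩
  exact_mod_cast Polynomial.natDegree_map_le.trans hd

/-! ### The two families and their generators -/

/-- The numerical semigroup `{0} ∪ [e + 1, 2 e] ∪ [2 e + 2, ∞)`. -/
def intervalSemigroup (e : ℕ) : NumericalSemigroup where
  carrier := {n | n = 0 ∨ e + 1 ≤ n ∧ n ≠ 2 * e + 1}
  zero_mem' := Or.inl rfl
  add_mem' := by
    intro a b ha hb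
    simp only [Set.mem_ofPred_eq] at *
    omega
  finite_compl := (Set.finite_Iio (2 * e + 2)).subset fun n hn => by
    simp only [Set.mem_compl_iff, Set.mem_ofPred_eq, Set.mem_Iio] at *
    omega

/-- The numerical semigroup `{0, e + 1} ∪ [e + 3, 2 e + 2] ∪ [2 e + 4, ∞)`. -/
def puncturedIntervalSemigroup (e : ℕ) (he : 0 < e) : NumericalSemigroup where
  carrier := {n | n = 0 ∨ e + 1 ≤ n ∧ n ≠ e + 2 ∧ n ≠ 2 * e + 3}
  zero_mem' := Or.inl rfl
  add_mem' := by
    intro a b ha hb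
    simp only [Set.mem_ofPred_eq] at *
    omega
  finite_compl := (Set.finite_Iio (2 * e + 4)).subset fun n hn => by
    simp only [Set.mem_compl_iff, Set.mem_ofPred_eq, Set.mem_Iio] at *
    omega

theorem mem_intervalSemigroup {e n : ℕ} :
    n ∈ (intervalSemigroup e).toAddSubmonoid ↔ n = 0 ∨ e + 1 ≤ n ∧ n ≠ 2 * e + 1 := Iff.rfl

theorem mem_puncturedIntervalSemigroup {e n : ℕ} {he : 0 < e} :
    n ∈ (puncturedIntervalSemigroup e he).toAddSubmonoid ↔
      n = 0 ∨ e + 1 ≤ n ∧ n ≠ e + 2 ∧ n ≠ 2 * e + 3 := Iff.rfl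

theorem intervalSemigroup_hasEmbeddingDimension {e : ℕ} (he : 2 ≤ e) :
    (intervalSemigroup e).HasEmbeddingDimension e := by
  have hcard : (Finset.Icc (e + 1) (2 * e)).card = e := by
    rw [Nat.card_Icc]; omega
  have hgen : ∀ n, e + 1 ≤ n → n ≠ 2 * e + 1 →
      n ∈ AddSubmonoid.closure (Finset.Icc (e + 1) (2 * e) : Set ℕ) := by
    have hsub : ∀ n, e + 1 ≤ n → n ≤ 2 * e →
        n ∈ AddSubmonoid.closure (Finset.Icc (e + 1) (2 * e) : Set ℕ) := fun n h1 h2 =>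
      AddSubmonoid.subset_closure (by simp [h1, h2])
    intro n
    induction n using Nat.strong_induction_on with
    | _ n ih =>
      intro h1 h2
      by_cases h3 : n ≤ 2 * e
      · exact hsub n h1 h3
      -- Subtracting e + 1 lands on the gap 2e + 1 exactly here, so another decomposition is needed.
      by_cases h4 : n = 3 * e + 2
      · rw [show n = (e + 2) + 2 * e by omega]
        exact add_mem (hsub _ (by omega) (by omega)) (hsub _ (by omega) (by omega))
      · rw [show n = (e + 1) + (n - (e + 1)) by omega]
        exact add_mem (hsub _ le_rfl (by omega)) (ih _ (by omega) (by omega) (by omega))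
  have h := hasEmbeddingDimension_of_subset_Ico (S := intervalSemigroup e)
    (A := Finset.Icc (e + 1) (2 * e)) (m := e + 1)
    (fun n hn => by simp only [Finset.mem_Icc, Finset.mem_Ico] at *; omega)
    (le_antisymm (AddSubmonoid.closure_le.2 fun n hn => by
        simp only [Finset.coe_Icc, Set.mem_Icc] at hn
        exact Or.inr ⟨hn.1, by omega⟩)
      fun n hn => by
        rcases mem_intervalSemigroup.1 hn with rfl | hn
        · exact zero_mem _
        · exact hgen n hn.1 hn.2)
  rwa [hcard] at h

theorem puncturedIntervalSemigroup_hasEmbeddingDimension {e : ℕ} (he : 2 ≤ e) (he' : 0 < e) :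
    (puncturedIntervalSemigroup e he').HasEmbeddingDimension e := by
  set A : Finset ℕ := insert (e + 1) (Finset.Icc (e + 3) (2 * e + 1)) with hA
  have hmem : ∀ n, n ∈ A ↔ n = e + 1 ∨ e + 3 ≤ n ∧ n ≤ 2 * e + 1 := by simp [hA]
  have hcard : A.card = e := by
    rw [hA, Finset.card_insert_of_notMem (by simp), Nat.card_Icc]; omega
  have hsub : ∀ n, n = e + 1 ∨ e + 3 ≤ n ∧ n ≤ 2 * e + 1 →
      n ∈ AddSubmonoid.closure (A : Set ℕ) := fun n hn =>
    AddSubmonoid.subset_closure (Finset.mem_coe.2 ((hmem n).2 hn))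
  have hgen : ∀ n, e + 1 ≤ n → n ≠ e + 2 → n ≠ 2 * e + 3 →
      n ∈ AddSubmonoid.closure (A : Set ℕ) := by
    intro n
    induction n using Nat.strong_induction_on with
    | _ n ih =>
      intro h1 h2 h3
      by_cases h4 : n ≤ 2 * e + 1
      · exact hsub n (by omega)
      -- The only case where subtracting e + 1 lands on the gap 2e + 3; it cannot land on e + 2,
      -- since n ≠ 2e + 3.
      by_cases h5 : n = 3 * e + 4
      · rw [show n = (e + 3) + (2 * e + 1) by omega]
        exact add_mem (hsub _ (by omega)) (hsub _ (by omega))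
      · rw [show n = (e + 1) + (n - (e + 1)) by omega]
        exact add_mem (hsub _ (by omega)) (ih _ (by omega) (by omega) (by omega) (by omega))
  have h := hasEmbeddingDimension_of_subset_Ico (S := puncturedIntervalSemigroup e he')
    (A := A) (m := e + 1)
    (fun n hn => by rw [hmem] at hn; rw [Finset.mem_Ico]; omega)
    (le_antisymm (AddSubmonoid.closure_le.2 fun n hn => by
        have := (hmem n).1 hn
        refine Or.inr ⟨?_, ?_, ?_⟩ <;> omega)
      fun n hn => by
        rcases mem_puncturedIntervalSemigroup.1 hn with rfl | hn
        · exact zero_mem _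
        · exact hgen n hn.1 hn.2.1 hn.2.2)
  rwa [hcard] at h

/-! ### Semigroup polynomials and symmetry -/

open Polynomial in
theorem intervalSemigroup_semigroupPolynomial (e : ℕ) :
    (intervalSemigroup e).semigroupPolynomial =
      1 - X + X ^ (e + 1) - X ^ (2 * e + 1) + X ^ (2 * e + 2) := by
  -- Adjoining 0 completes the gaps below e + 1 to an initial segment, whose sum is geometric.
  have hgaps : insert 0 (intervalSemigroup e).gaps =
      insert (2 * e + 1) (Finset.range (e + 1)) := by
    ext n
    simp only [gaps, intervalSemigroup, Set.Finite.mem_toFinset, Finset.mem_insert,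
      Finset.mem_range, Set.mem_compl_iff, Set.mem_ofPred_eq]
    omega
  have h0 : 0 ∉ (intervalSemigroup e).gaps := by simp [gaps, intervalSemigroup]
  have h := congrArg (fun s => ∑ g ∈ s, (X : ℤ[X]) ^ g) hgaps
  simp only [Finset.sum_insert h0] at h
  rw [Finset.sum_insert (by simp; omega)] at h
  have hg := mul_neg_geom_sum (X : ℤ[X]) (e + 1)
  rw [semigroupPolynomial]
  linear_combination (X - 1) * h - hg

open Polynomial in
theorem puncturedIntervalSemigroup_semigroupPolynomial (e : ℕ) (he : 0 < e) :
    (puncturedIntervalSemigroup e he).semigroupPolynomial =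
      1 - X + X ^ (e + 1) - X ^ (e + 2) + X ^ (e + 3) - X ^ (2 * e + 3) + X ^ (2 * e + 4) := by
  have hgaps : insert 0 (puncturedIntervalSemigroup e he).gaps =
      insert (2 * e + 3) (insert (e + 2) (Finset.range (e + 1))) := by
    ext n
    simp only [gaps, puncturedIntervalSemigroup, Set.Finite.mem_toFinset, Finset.mem_insert,
      Finset.mem_range, Set.mem_compl_iff, Set.mem_ofPred_eq]
    omega
  have h0 : 0 ∉ (puncturedIntervalSemigroup e he).gaps := by
    simp [gaps, puncturedIntervalSemigroup]
  have h := congrArg (fun s => ∑ g ∈ s, (X : ℤ[X]) ^ g) hgaps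
  simp only [Finset.sum_insert h0] at h
  rw [Finset.sum_insert (by simp; omega), Finset.sum_insert (by simp)] at h
  have hg := mul_neg_geom_sum (X : ℤ[X]) (e + 1)
  rw [semigroupPolynomial]
  linear_combination (X - 1) * h - hg

theorem intervalSemigroup_isSymmetric (e : ℕ) : (intervalSemigroup e).IsSymmetric := by
  -- The exponent is the degree: the polynomial is palindromic.
  refine ⟨2 * e + 2, ?_⟩
  rw [intervalSemigroup_semigroupPolynomial]
  simp only [map_add, map_sub, map_one, Polynomial.toLaurent_X, Polynomial.toLaurent_X_pow,
    LaurentPolynomial.invert_T, mul_add, mul_sub, ← LaurentPolynomial.T_add, mul_one]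
  push_cast
  ring_nf
  simp only [LaurentPolynomial.T_zero]
  ring

theorem puncturedIntervalSemigroup_isSymmetric (e : ℕ) (he : 0 < e) :
    (puncturedIntervalSemigroup e he).IsSymmetric := by
  refine ⟨2 * e + 4, ?_⟩
  rw [puncturedIntervalSemigroup_semigroupPolynomial]
  simp only [map_add, map_sub, map_one, Polynomial.toLaurent_X, Polynomial.toLaurent_X_pow,
    LaurentPolynomial.invert_T, mul_add, mul_sub, ← LaurentPolynomial.T_add, mul_one]
  push_cast
  ring_nf
  simp only [LaurentPolynomial.T_zero]
  ring

/-! ### Failure of cyclotomicity -/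

theorem intervalSemigroup_not_isCyclotomic {e : ℕ} (he : 4 ≤ e) :
    ¬ (intervalSemigroup e).IsCyclotomic := by
  intro hc
  obtain ⟨Q, hQ, hn⟩ := hc.exists_logDeriv_coeff_le (d := 2 * e + 2)
    (by rw [intervalSemigroup_semigroupPolynomial]; simp [Polynomial.coeff_X_pow])
    (by rw [intervalSemigroup_semigroupPolynomial]; compute_degree; omega)
  set q : ℕ → ℂ := fun n => PowerSeries.coeff n Q
  -- The n-th coefficient of P · Q = P'; the right side is the coefficient of P'.
  have hrec : ∀ n, q n - (if 1 ≤ n then q (n - 1) else 0)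
      + (if e + 1 ≤ n then q (n - (e + 1)) else 0)
      - (if 2 * e + 1 ≤ n then q (n - (2 * e + 1)) else 0)
      + (if 2 * e + 2 ≤ n then q (n - (2 * e + 2)) else 0)
      = - (if n = 0 then 1 else 0) + (if n = e then (e + 1 : ℂ) else 0)
        - (if n = 2 * e then (2 * e + 1 : ℂ) else 0)
        + (if n = 2 * e + 1 then (2 * e + 2 : ℂ) else 0) := by
    intro n
    have h := congrArg (PowerSeries.coeff n) hQ
    rw [intervalSemigroup_semigroupPolynomial] at h
    simp only [Polynomial.map_add, Polynomial.map_sub, Polynomial.map_one, Polynomial.map_X,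
      Polynomial.map_pow, Polynomial.coe_add, Polynomial.coe_sub, Polynomial.coe_one,
      Polynomial.coe_X, Polynomial.coe_pow, add_mul, sub_mul, one_mul, map_add, map_sub,
      PowerSeries.coeff_X_pow_mul', Polynomial.coeff_coe, Polynomial.derivative_X_pow,
      Polynomial.derivative_X, Polynomial.derivative_one, Polynomial.coeff_C_mul,
      Polynomial.coeff_X_pow] at h
    have hX : PowerSeries.coeff n (PowerSeries.X * Q) = if 1 ≤ n then q (n - 1) else 0 := by
      simpa using PowerSeries.coeff_X_pow_mul' Q 1 n
    rw [hX] at h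
    refine h.trans ?_
    simp
  have low : ∀ k, k < e → q k = -1 := by
    intro k
    induction k with
    | zero =>
      intro hk
      have h := hrec 0
      simp (disch := omega) only [if_neg, if_true] at h
      linear_combination h
    | succ k ih =>
      intro hk
      have h := hrec (k + 1)
      simp (disch := omega) only [if_pos, if_neg, Nat.add_sub_cancel] at h
      linear_combination h + ih (by omega)
  -- The source term e + 1 lifts -1 to e; afterwards the delayed term -q(i) = 1 raises each value by
  -- one.
  have mid : ∀ i, i < e → q (e + i) = e + i := by
    intro i
    induction i with
    | zero =>
      intro hi
      have h := hrec e
      simp (disch := omega) only [if_pos, if_neg, if_true] at h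
      push_cast
      rw [add_zero]
      linear_combination h + low (e - 1) (by omega)
    | succ i ih =>
      intro hi
      have h := hrec (e + (i + 1))
      simp (disch := omega) only [if_pos, if_neg, show e + (i + 1) - 1 = e + i by omega,
        show e + (i + 1) - (e + 1) = i by omega] at h
      push_cast
      linear_combination h + ih (by omega) - low i (by omega)
  -- From 2e on the values are -1, e, -1, -(e + 3), -(2e + 6). The last uses q(e + 3) from `mid`,
  -- hence e ≥ 4.
  have h0 := hrec (2 * e)
  have h1 := hrec (2 * e + 1)
  have h2 := hrec (2 * e + 2)
  have h3 := hrec (2 * e + 3)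
  have h4 := hrec (2 * e + 4)
  simp (disch := omega) only [if_pos, if_neg, if_true, show 2 * e - 1 = e + (e - 1) by omega,
    show 2 * e - (e + 1) = e - 1 by omega, mid, low] at h0
  simp (disch := omega) only [if_pos, if_neg, if_true, show 2 * e + 1 - 1 = 2 * e by omega,
    show 2 * e + 1 - (e + 1) = e + 0 by omega, mid, low] at h1
  simp (disch := omega) only [if_pos, if_neg, show 2 * e + 2 - 1 = 2 * e + 1 by omega,
    show 2 * e + 2 - (e + 1) = e + 1 by omega, mid, low] at h2
  simp (disch := omega) only [if_pos, if_neg, show 2 * e + 3 - 1 = 2 * e + 2 by omega,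
    show 2 * e + 3 - (e + 1) = e + 2 by omega, mid, low] at h3
  simp (disch := omega) only [if_pos, if_neg, show 2 * e + 4 - 1 = 2 * e + 3 by omega,
    show 2 * e + 4 - (e + 1) = e + 3 by omega, mid, low] at h4
  rw [Nat.cast_sub (by omega)] at h0
  push_cast at h0 h1 h2 h3 h4
  have hval : q (2 * e + 4) = ((-(2 * e + 6) : ℝ) : ℂ) := by
    push_cast
    linear_combination h0 + h1 + h2 + h3 + h4
  have hle := hn (2 * e + 4)
  change ‖q (2 * e + 4)‖ ≤ _ at hle
  rw [hval, Complex.norm_real, norm_neg, Real.norm_of_nonneg (by positivity)] at hle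
  push_cast at hle
  linarith

theorem puncturedIntervalSemigroup_not_isCyclotomic {e : ℕ} (he : 4 ≤ e) (he' : 0 < e) :
    ¬ (puncturedIntervalSemigroup e he').IsCyclotomic := by
  intro hc
  obtain ⟨Q, hQ, hn⟩ := hc.exists_logDeriv_coeff_le (d := 2 * e + 4)
    (by rw [puncturedIntervalSemigroup_semigroupPolynomial]; simp [Polynomial.coeff_X_pow])
    (by rw [puncturedIntervalSemigroup_semigroupPolynomial]; compute_degree; omega)
  set q : ℕ → ℂ := fun n => PowerSeries.coeff n Q
  have hrec : ∀ n, q n - (if 1 ≤ n then q (n - 1) else 0)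
      + (if e + 1 ≤ n then q (n - (e + 1)) else 0)
      - (if e + 2 ≤ n then q (n - (e + 2)) else 0)
      + (if e + 3 ≤ n then q (n - (e + 3)) else 0)
      - (if 2 * e + 3 ≤ n then q (n - (2 * e + 3)) else 0)
      + (if 2 * e + 4 ≤ n then q (n - (2 * e + 4)) else 0)
      = - (if n = 0 then 1 else 0) + (if n = e then (e + 1 : ℂ) else 0)
        - (if n = e + 1 then (e + 2 : ℂ) else 0)
        + (if n = e + 2 then (e + 3 : ℂ) else 0)
        - (if n = 2 * e + 2 then (2 * e + 3 : ℂ) else 0)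
        + (if n = 2 * e + 3 then (2 * e + 4 : ℂ) else 0) := by
    intro n
    have h := congrArg (PowerSeries.coeff n) hQ
    rw [puncturedIntervalSemigroup_semigroupPolynomial] at h
    simp only [Polynomial.map_add, Polynomial.map_sub, Polynomial.map_one, Polynomial.map_X,
      Polynomial.map_pow, Polynomial.coe_add, Polynomial.coe_sub, Polynomial.coe_one,
      Polynomial.coe_X, Polynomial.coe_pow, add_mul, sub_mul, one_mul, map_add, map_sub,
      PowerSeries.coeff_X_pow_mul', Polynomial.coeff_coe, Polynomial.derivative_X_pow,
      Polynomial.derivative_X, Polynomial.derivative_one, Polynomial.coeff_C_mul,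
      Polynomial.coeff_X_pow] at h
    have hX : PowerSeries.coeff n (PowerSeries.X * Q) = if 1 ≤ n then q (n - 1) else 0 := by
      simpa using PowerSeries.coeff_X_pow_mul' Q 1 n
    rw [hX] at h
    refine h.trans ?_
    simp
  have low : ∀ k, k < e → q k = -1 := by
    intro k
    induction k with
    | zero =>
      intro hk
      have h := hrec 0
      simp (disch := omega) only [if_neg, if_true] at h
      linear_combination h
    | succ k ih =>
      intro hk
      have h := hrec (k + 1)
      simp (disch := omega) only [if_pos, if_neg, Nat.add_sub_cancel] at h
      linear_combination h + ih (by omega)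
  have hm0 : q e = e := by
    have h := hrec e
    simp (disch := omega) only [if_pos, if_neg, if_true, low] at h
    linear_combination h
  have hm1 : q (e + 1) = -1 := by
    have h := hrec (e + 1)
    simp (disch := omega) only [if_pos, if_neg, if_true, Nat.add_sub_cancel, Nat.sub_self, low] at h
    linear_combination h + hm0
  -- Past e + 2 the three delayed terms all equal -1 and enter with signs -, +, -, so each step adds
  -- 1.
  have mid : ∀ i, i + 1 < e → q (e + 2 + i) = e + 2 + i := by
    intro i
    induction i with
    | zero =>
      intro hi
      have h := hrec (e + 2)
      simp (disch := omega) only [if_pos, if_neg, if_true, show e + 2 - 1 = e + 1 by omega, low] at h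
      push_cast
      rw [add_zero]
      linear_combination h + hm1
    | succ i ih =>
      intro hi
      have h := hrec (e + 2 + (i + 1))
      simp (disch := omega) only [if_pos, if_neg, show e + 2 + (i + 1) - 1 = e + 2 + i by omega,
        low] at h
      push_cast
      linear_combination h + ih (by omega)
  have large : ∀ n (r : ℝ), q n = ((-r : ℝ) : ℂ) → r ≤ 2 * e + 4 := by
    intro n r hr
    have hle := hn n
    change ‖q n‖ ≤ _ at hle
    rw [hr, Complex.norm_real, norm_neg] at hle
    push_cast at hle
    exact (le_abs_self r).trans hle
  have h1 := hrec (2 * e + 1)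
  simp (disch := omega) only [if_pos, if_neg, show 2 * e + 1 - 1 = e + 2 + (e - 2) by omega,
    show 2 * e + 1 - (e + 1) = e by omega, mid, low] at h1
  have h2 := hrec (2 * e + 2)
  simp (disch := omega) only [if_pos, if_neg, if_true, show 2 * e + 2 - 1 = 2 * e + 1 by omega,
    show 2 * e + 2 - (e + 1) = e + 1 by omega,
    show 2 * e + 2 - (e + 2) = e by omega, low] at h2
  have h3 := hrec (2 * e + 3)
  simp (disch := omega) only [if_pos, if_neg, if_true, show 2 * e + 3 - 1 = 2 * e + 2 by omega,
    show 2 * e + 3 - (e + 1) = e + 2 + 0 by omega,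
    show 2 * e + 3 - (e + 2) = e + 1 by omega,
    show 2 * e + 3 - (e + 3) = e by omega, mid, low] at h3
  have h4 := hrec (2 * e + 4)
  simp (disch := omega) only [if_pos, if_neg, show 2 * e + 4 - 1 = 2 * e + 3 by omega,
    show 2 * e + 4 - (e + 1) = e + 2 + 1 by omega,
    show 2 * e + 4 - (e + 2) = e + 2 + 0 by omega,
    show 2 * e + 4 - (e + 3) = e + 1 by omega, mid, low] at h4
  rw [Nat.cast_sub (by omega)] at h1
  push_cast at h1 h2 h3 h4
  have e1 : q (2 * e + 1) = e := by linear_combination h1 - hm0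
  have e2 : q (2 * e + 2) = -1 := by linear_combination h2 + e1 + hm0 - hm1
  have e3 : q (2 * e + 3) = -1 := by linear_combination h3 + e2 + hm1 - hm0
  have e4 : q (2 * e + 4) = -1 := by linear_combination h4 + e3 - hm1
  -- The value at 2e + 6 uses q(e + 5), which `mid` covers only for e ≥ 5. For e = 4 that
  -- coefficient is -11, within the bound 12, so the recursion is run on to 16.
  obtain rfl | he5 := he.eq_or_lt
  · have h13 := hrec 13
    have h14 := hrec 14
    have h15 := hrec 15
    have h16 := hrec 16
    have m0 := mid 0 (by norm_num)
    have m1 := mid 1 (by norm_num)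
    have m2 := mid 2 (by norm_num)
    have l1 := low 1 (by norm_num)
    have l2 := low 2 (by norm_num)
    have l3 := low 3 (by norm_num)
    norm_num at h13 h14 h15 h16 m0 m1 m2 hm0 hm1 e1 e2 e3 e4
    rw [e4, m2, m1, m0, l1, l2] at h13
    rw [e1, m2, m1, l2, l3] at h14
    rw [e1, e2, m2, hm0, l3] at h15
    rw [e1, e2, e3, hm0, hm1] at h16
    have := large 16 18 (by push_cast; linear_combination h13 + h14 + h15 + h16)
    norm_num at this
  · have h5 := hrec (2 * e + 5)
    have h6 := hrec (2 * e + 6)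
    simp (disch := omega) only [if_pos, if_neg, show 2 * e + 5 - 1 = 2 * e + 4 by omega,
      show 2 * e + 5 - (e + 1) = e + 2 + 2 by omega,
      show 2 * e + 5 - (e + 2) = e + 2 + 1 by omega,
      show 2 * e + 5 - (e + 3) = e + 2 + 0 by omega, mid, low] at h5
    simp (disch := omega) only [if_pos, if_neg, show 2 * e + 6 - 1 = 2 * e + 5 by omega,
      show 2 * e + 6 - (e + 1) = e + 2 + 3 by omega,
      show 2 * e + 6 - (e + 2) = e + 2 + 2 by omega,
      show 2 * e + 6 - (e + 3) = e + 2 + 1 by omega, mid, low] at h6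
    push_cast at h5 h6
    have := large (2 * e + 6) (2 * e + 8) (by push_cast; linear_combination h6 + h5 + e4)
    linarith

end NumericalSemigroup

theorem theorem2 (e : ℕ) (he : 4 ≤ e) :
    (∃ S T : NumericalSemigroup, S ≠ T ∧
      (S.HasEmbeddingDimension e ∧ S.IsSymmetric ∧ ¬ S.IsCyclotomic) ∧
      (T.HasEmbeddingDimension e ∧ T.IsSymmetric ∧ ¬ T.IsCyclotomic)) ∧
    NumericalSemigroup.CY e ≠ NumericalSemigroup.SY e := by
  have he' : 0 < e := by omega
  have hdim := NumericalSemigroup.intervalSemigroup_hasEmbeddingDimension (e := e) (by omega)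
  have hsym := NumericalSemigroup.intervalSemigroup_isSymmetric e
  have hcyc := NumericalSemigroup.intervalSemigroup_not_isCyclotomic he
  refine ⟨⟨.intervalSemigroup e, .puncturedIntervalSemigroup e he', fun h => ?_,
    ⟨hdim, hsym, hcyc⟩,
    NumericalSemigroup.puncturedIntervalSemigroup_hasEmbeddingDimension (by omega) he',
    NumericalSemigroup.puncturedIntervalSemigroup_isSymmetric e he',
    NumericalSemigroup.puncturedIntervalSemigroup_not_isCyclotomic he he'⟩, fun h => ?_⟩
  · have h1 : e + 2 ∈ (NumericalSemigroup.intervalSemigroup e).toAddSubmonoid :=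
      NumericalSemigroup.mem_intervalSemigroup.2 (by omega)
    rw [h, NumericalSemigroup.mem_puncturedIntervalSemigroup] at h1
    omega
  · have h1 : NumericalSemigroup.intervalSemigroup e ∈ NumericalSemigroup.SY e := ⟨hdim, hsym⟩
    rw [← h] at h1
    exact hcyc h1.2
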